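/- Let $n\ge 1$, let $M$ be an oriented smooth $n$-manifold with (possibly empty) boundary $\partial M$ (Hausdorff, $\sigma$-compact), and let $A$ be a smooth manifold diffeomorphic to the space of inner products on $\mathbb R^n$, with a $\sigma$-finite Borel measure $da$. Write $\Omega^k(M)$ for the smooth $k$-forms on $M$ and $d_M$ for the exterior derivative. A *statistical derivative* on $M$ is given by the following data. For each $m\in M$ let $f(m,\cdot)$ be a distribution on $A$ of total weight one, i.e. a Borel probability measure $f(m,db)$ on $A$ (for instance $f(m,b)\,db$ with $f\ge 0$ and $\int_A f(m,b)\,db=1$). For each $a\in A$ let $\exp_a$ be a linear automorphism of each of the spaces $\Omega^{n-1}(M)$ and $\Omega^n(M)$. Put $$d_{(M;a)}\,\eta\,(m)=\int_{A}\bigl(\exp_a\circ d_M\circ \exp_b^{-1}\,\eta\bigr)(m)\;f(m,db),\qquad \eta\in\Omega^{n-1}(M).$$ Assume that 1. (conservation of probabilistic flux) every $\exp_a$ is constant with respect to $d_M$: $d_M(\exp_a\eta)=\exp_a(d_M\eta)$ for all $\eta\in\Omega^{n-1}(M)$ (for the multiplication by a function $g$ this says $dg=0$); 2. (normalisation) $\int_A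 \exp_a\exp_b^{-1}\,f(\cdot,db)=\mathrm{Id}$ on $\Omega^{n-1}(M)$ and on $\Omega^{n}(M)$, that is, for all $a\in A$, all $m\in M$ and all such forms $\eta$, the function $b\mapsto(\exp_a\exp_b^{-1}\eta)(m)$ is $f(m,\cdot)$-integrable with integral $\eta(m)$. Let $\omega(m,a)$ be a family of smooth $(n-1)$-forms on $M$, depending smoothly on $(m,a)\in M\times A$ and vanishing for $m$ outside a compact subset of $M$ that does not depend on $a$ (no condition if $M$ is compact). Assume that the integrals below converge absolutely, i.e. that, in every chart of $M$, the coefficients of $d_{(M;a)}\omega(m,a)$ are integrable over $C\times A$ for compact subsets $C$ of the chart, and the coefficients of $\omega(m,a)$ are integrable over $C\times A$ for compact subsets $C$ of the boundary part of the chart. Then $$\int_M\int_A d_{(M;a)}\,\omega(m,a)\,da=\int_{\partial M}\int_A\omega(m,a)\,da ,$$ where $\partial M$ carries the boundary orientation (outward normal first). -/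

import Mathlib

open Set MeasureTheory
open scoped Manifold ContDiff Topology

namespace StatStokes

/-! ### The space of inner products on `ℝⁿ` -/

/-- Symmetric `n × n` matrices, i.e. (the coefficients of) symmetric bilinear forms on `ℝⁿ`. -/
def symmForms (n : ℕ) : Submodule ℝ (Fin n → Fin n → ℝ) where
  carrier := {a | ∀ i j, a i j = a j i}
  add_mem' := by
    intro a b ha hb i j
    simp [ha i j, hb i j]
  zero_mem' := by
    intro i j
    simp
  smul_mem' := by
    intro c a ha i j
    simp [ha i j]

theorem isOpen_posDef (n : ℕ) :
    IsOpen {a : symmForms n |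
      ∀ v : Fin n → ℝ, v ≠ 0 → 0 < ∑ i, ∑ j, a.1 i j * (v i * v j)} := by
  have h1 : {a : symmForms n | ∀ v : Fin n → ℝ, v ≠ 0 → 0 < ∑ i, ∑ j, a.1 i j * (v i * v j)} =
      {a : symmForms n | ∀ v ∈ Metric.sphere (0 : Fin n → ℝ) 1,
        0 < ∑ i, ∑ j, a.1 i j * (v i * v j)} := by
    ext a
    constructor
    · intro h v hv
      exact h v (ne_zero_of_mem_unit_sphere (⟨v, hv⟩ : Metric.sphere _ _))
    · intro h v hv
      have hn : 0 < ‖v‖ := norm_pos_iff.mpr hv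
      have h2 := h (‖v‖⁻¹ • v) (by simp [norm_smul, hn.ne'])
      have h3 : ∑ i, ∑ j, a.1 i j * ((‖v‖⁻¹ • v) i * (‖v‖⁻¹ • v) j) =
          (‖v‖⁻¹ * ‖v‖⁻¹) * ∑ i, ∑ j, a.1 i j * (v i * v j) := by
        simp only [Finset.mul_sum, Pi.smul_apply, smul_eq_mul]
        refine Finset.sum_congr rfl fun i _ => Finset.sum_congr rfl fun j _ => ?_
        ring
      rw [h3] at h2
      exact pos_of_mul_pos_right h2 (by positivity)
  have hc : Continuous fun p : symmForms n × (Fin n → ℝ) =>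
      ∑ i, ∑ j, p.1.1 i j * (p.2 i * p.2 j) := by
    refine continuous_finsetSum _ fun i _ => continuous_finsetSum _ fun j _ => ?_
    exact ((continuous_apply_apply i j).comp (continuous_subtype_val.comp continuous_fst)).mul
      (((continuous_apply i).comp continuous_snd).mul ((continuous_apply j).comp continuous_snd))
  have hO : IsOpen {p : symmForms n × (Fin n → ℝ) | 0 < ∑ i, ∑ j, p.1.1 i j * (p.2 i * p.2 j)} :=
    isOpen_lt continuous_const hc
  rw [h1, isOpen_iff_mem_nhds]
  intro a ha
  have h2 := (isCompact_sphere (0 : Fin n → ℝ) 1).eventually_forall_of_forall_eventually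
    (x₀ := a) (P := fun a v => 0 < ∑ i, ∑ j, a.1 i j * (v i * v j))
    fun v hv => hO.mem_nhds (ha v hv)
  exact h2

/-- The space of inner products (symmetric positive definite bilinear forms) on `ℝⁿ`, an open
subset of the vector space of symmetric bilinear forms, and thereby a smooth manifold. -/
def innerProducts (n : ℕ) : TopologicalSpace.Opens (symmForms n) :=
  ⟨{a | ∀ v : Fin n → ℝ, v ≠ 0 → 0 < ∑ i, ∑ j, a.1 i j * (v i * v j)}, isOpen_posDef n⟩

/-! ### Differential forms on a manifold with boundary

`M` is a smooth manifold with boundary of dimension `n + 1`, modelled on the half space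
`{x | 0 ≤ x 0}` of `ℝⁿ⁺¹`. In Mathlib `TangentSpace (𝓡∂ (n + 1)) m` is `ℝⁿ⁺¹` by definition: a
tangent vector at `m` is given by its coordinates in the preferred chart at `m`. -/

/-- Differential forms of degree `k` on `M` (no regularity): alternating `k`-linear forms on the
tangent spaces. -/
abbrev DForm (n : ℕ) (M : Type*) (k : ℕ) : Type _ :=
  M → EuclideanSpace ℝ (Fin (n + 1)) [⋀^Fin k]→L[ℝ] ℝ

section Forms

variable {n : ℕ} {M : Type*} [TopologicalSpace M]
  [ChartedSpace (EuclideanHalfSpace (n + 1)) M] [IsManifold (𝓡∂ (n + 1)) ∞ M]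

/-- The expression of `η` in the preferred chart `φ` at `i`, i.e. the pullback `(φ⁻¹)^* η`, a form
on the target of `φ` in the half space. -/
noncomputable def inChart {k : ℕ} (i : M) (η : DForm n M k) (y : EuclideanSpace ℝ (Fin (n + 1))) :
    EuclideanSpace ℝ (Fin (n + 1)) [⋀^Fin k]→L[ℝ] ℝ :=
  (η ((extChartAt (𝓡∂ (n + 1)) i).symm y)).compContinuousLinearMap
    (tangentCoordChange (𝓡∂ (n + 1)) i ((extChartAt (𝓡∂ (n + 1)) i).symm y)
      ((extChartAt (𝓡∂ (n + 1)) i).symm y))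

/-- Smooth forms: smooth in every chart, up to the boundary. -/
def IsSmoothForm {k : ℕ} (η : DForm n M k) : Prop :=
  ∀ i : M, ContDiffOn ℝ ∞ (inChart i η) (extChartAt (𝓡∂ (n + 1)) i).target

/-- The exterior derivative `d_M`. -/
noncomputable def dM {k : ℕ} (η : DForm n M k) : DForm n M (k + 1) := fun m =>
  extDerivWithin (inChart m η) (range (𝓡∂ (n + 1))) (extChartAt (𝓡∂ (n + 1)) m m)

/-- A family of forms `θ(m, a)` on `M`, smooth jointly in `m ∈ M` and in the parameter `a ∈ A`. -/
def IsSmoothFamily {V A : Type*} [NormedAddCommGroup V] [NormedSpace ℝ V] [TopologicalSpace A]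
    [ChartedSpace V A] {k : ℕ} (θ : A → DForm n M k) : Prop :=
  ∀ i : M, ContMDiffOn ((𝓘(ℝ, EuclideanSpace ℝ (Fin (n + 1)))).prod 𝓘(ℝ, V))
    𝓘(ℝ, EuclideanSpace ℝ (Fin (n + 1)) [⋀^Fin k]→L[ℝ] ℝ) ∞
    (fun p : EuclideanSpace ℝ (Fin (n + 1)) × A => inChart i (θ p.2) p.1)
    ((extChartAt (𝓡∂ (n + 1)) i).target ×ˢ univ)

variable (n M) in
/-- An orientation of `M`. The number `sign m = ± 1` tells whether the standard basis of `T_m M`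
(the coordinate basis of the preferred chart at `m`) is positively oriented. -/
structure MOrientation where
  /-- the orientation of `T_m M` relative to its standard basis -/
  sign : M → ℝ
  sign_eq : ∀ m, sign m = 1 ∨ sign m = -1
  /-- The sign of the coordinate basis of any given chart is locally constant. -/
  continuousOn_sign : ∀ i : M, ContinuousOn
    (fun m => sign m * Real.sign (tangentCoordChange (𝓡∂ (n + 1)) i m m).det)
    (extChartAt (𝓡∂ (n + 1)) i).source

/-- The sign `± 1` of the preferred chart at `i`, at the point `m` of its domain: whether its
coordinate basis is positively oriented. -/
noncomputable def MOrientation.chartSign (o : MOrientation n M) (i m : M) : ℝ :=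
  o.sign m * Real.sign (tangentCoordChange (𝓡∂ (n + 1)) i m m).det

/-- The point `(0, x)` of the boundary hyperplane of the half space of `ℝⁿ⁺¹`. -/
noncomputable def bdryPt (x : EuclideanSpace ℝ (Fin n)) : EuclideanSpace ℝ (Fin (n + 1)) :=
  WithLp.toLp 2 (Fin.cons 0 x.ofLp)

variable (n M) in
/-- A smooth partition of unity subordinate to the charts of `M`. -/
noncomputable def chartPartition [T2Space M] [SigmaCompactSpace M] :
    SmoothPartitionOfUnity M (𝓡∂ (n + 1)) M univ :=
  (SmoothPartitionOfUnity.exists_isSubordinate_chartAt_source (𝓡∂ (n + 1)) M).choose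

theorem chartPartition_isSubordinate [T2Space M] [SigmaCompactSpace M] :
    (chartPartition n M).IsSubordinate
      fun i => (chartAt (EuclideanHalfSpace (n + 1)) i).source :=
  (SmoothPartitionOfUnity.exists_isSubordinate_chartAt_source (𝓡∂ (n + 1)) M).choose_spec

/-- The integral `∫_M η` of a form of top degree: the sum over the charts of the integrals of
`± ρ_i η(e_0, …, e_n)` in the coordinates of the chart. -/
noncomputable def integralM [T2Space M] [SigmaCompactSpace M] (o : MOrientation n M)
    (η : DForm n M (n + 1)) : ℝ :=
  ∑ᶠ i : M, ∫ y in (extChartAt (𝓡∂ (n + 1)) i).target,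
    o.chartSign i ((extChartAt (𝓡∂ (n + 1)) i).symm y) *
      (chartPartition n M i ((extChartAt (𝓡∂ (n + 1)) i).symm y) *
        inChart i η y fun j => EuclideanSpace.single j 1)

/-- The integral `∫_{∂M} η` of (the pullback to `∂M` of) a form of degree `dim M - 1`. In a chart,
`∂M` is the hyperplane `x_0 = 0` with the coordinates `x_1, …, x_n`. The boundary orientation is
the usual one, by the outward normal first; the outward normal is `- e_0`, so the coordinate basis
of `∂M` has the sign opposite to that of the chart. -/
noncomputable def integralBdry [T2Space M] [SigmaCompactSpace M] (o : MOrientation n M)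
    (η : DForm n M n) : ℝ :=
  ∑ᶠ i : M, ∫ x in {x : EuclideanSpace ℝ (Fin n) |
      bdryPt x ∈ (extChartAt (𝓡∂ (n + 1)) i).target},
    -o.chartSign i ((extChartAt (𝓡∂ (n + 1)) i).symm (bdryPt x)) *
      (chartPartition n M i ((extChartAt (𝓡∂ (n + 1)) i).symm (bdryPt x)) *
        inChart i η (bdryPt x) fun j => EuclideanSpace.single j.succ 1)

/-! ### Families of forms integrated over `A` -/

section Families

variable {A : Type*} [MeasurableSpace A]

/-- The form `∫_A θ(·, a) da`, the integral being taken in each fibre. -/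
noncomputable def integralA (ν : Measure A) {k : ℕ} (θ : A → DForm n M k) : DForm n M k :=
  fun m => ∫ a, θ a m ∂ν

/-- `∫_M ∫_A θ(m, a)` converges absolutely, locally on `M`: in every chart `θ(m, a)` is integrable
on `C × A`, for `C` a compact subset of the chart. -/
def AbsConvergesOnM (ν : Measure A) {k : ℕ} (θ : A → DForm n M k) : Prop :=
  ∀ (i : M) (C : Set (EuclideanSpace ℝ (Fin (n + 1)))), IsCompact C →
    C ⊆ (extChartAt (𝓡∂ (n + 1)) i).target →
    IntegrableOn (fun p : EuclideanSpace ℝ (Fin (n + 1)) × A => inChart i (θ p.2) p.1)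
      (C ×ˢ univ) (volume.prod ν)

/-- `∫_{∂M} ∫_A θ(m, a)` converges absolutely, locally on `∂M`. -/
def AbsConvergesOnBdry (ν : Measure A) {k : ℕ} (θ : A → DForm n M k) : Prop :=
  ∀ (i : M) (C : Set (EuclideanSpace ℝ (Fin n))), IsCompact C →
    (∀ x ∈ C, bdryPt x ∈ (extChartAt (𝓡∂ (n + 1)) i).target) →
    IntegrableOn (fun p : EuclideanSpace ℝ (Fin n) × A => inChart i (θ p.2) (bdryPt p.1))
      (C ×ˢ univ) (volume.prod ν)

end Families

/-! ### Statistical derivatives -/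

variable (n M) in
/-- A linear automorphism of the spaces of smooth forms on `M`, degree by degree. (The values on
forms that are not smooth are irrelevant.) -/
structure FormAut where
  /-- the operator -/
  op : ∀ k : ℕ, DForm n M k →ₗ[ℝ] DForm n M k
  /-- its inverse -/
  inv : ∀ k : ℕ, DForm n M k →ₗ[ℝ] DForm n M k
  smooth_op : ∀ (k : ℕ) (η : DForm n M k), IsSmoothForm η → IsSmoothForm (op k η)
  smooth_inv : ∀ (k : ℕ) (η : DForm n M k), IsSmoothForm η → IsSmoothForm (inv k η)
  op_inv : ∀ (k : ℕ) (η : DForm n M k), IsSmoothForm η → op k (inv k η) = η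
  inv_op : ∀ (k : ℕ) (η : DForm n M k), IsSmoothForm η → inv k (op k η) = η

/-- Conservation of probabilistic flux, `d_M exp_a = 0`, on forms of degree `k`: the operator is
constant with respect to `d_M`, that is, `d_M (exp_a η) = exp_a (d_M η)`. For the multiplication by
a function `g` this says `dg = 0`. -/
def ConservesFlux (e : FormAut n M) (k : ℕ) : Prop :=
  ∀ η : DForm n M k, IsSmoothForm η → dM (e.op k η) = e.op (k + 1) (dM η)

section Stat

variable {A : Type*} [MeasurableSpace A]

/-- The statistical derivative `d_{(M;a)} = ∫_A exp_a(m) ∘ d_M ∘ exp_b⁻¹(m) f(m, db)`, for a family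
`e` of operators `exp_a` and a family of distributions `f(m, ·)` on `A`. -/
noncomputable def statDeriv (f : M → Measure A) (e : A → FormAut n M) (a : A) {k : ℕ}
    (η : DForm n M k) : DForm n M (k + 1) :=
  fun m => ∫ b, (e a).op (k + 1) (dM ((e b).inv k η)) m ∂(f m)

/-- The normalisation `∫_A exp_a(m) exp_b⁻¹(m) f(m, db) = Id`, on forms of degree `k`. -/
def IsNormalised (f : M → Measure A) (e : A → FormAut n M) (k : ℕ) : Prop :=
  ∀ (a : A) (η : DForm n M k), IsSmoothForm η → ∀ m : M,
    Integrable (fun b => (e a).op k ((e b).inv k η) m) (f m) ∧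
      ∫ b, (e a).op k ((e b).inv k η) m ∂(f m) = η m

end Stat

end Forms

end StatStokes

/-!
The statistical derivative is the exterior derivative in disguise, and the theorem is Stokes'
theorem integrated over the parameter space.

Conservation of flux makes `exp_b⁻¹` commute with `d_M`, so
`exp_a (d_M (exp_b⁻¹ η)) = exp_a (exp_b⁻¹ (d_M η))`. As `d_M η` is again a smooth form, the
normalisation in top degree says that the mean of this over `b` is `d_M η` (`statDeriv_eq_dM`).
It remains to show `∫_M ∫_A d_M ω da = ∫_{∂M} ∫_A ω da`. By Fubini's theorem, in the finitely many
charts that meet the common compact support, both sides are integrals over `A` of integrals over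
`M` and `∂M` (`integralM_integralA`, `integralBdry_integralA`), and the integrands agree by Stokes'
theorem for a single smooth compactly supported form (`integralM_dM`).

The latter rests on three facts: `d_M` is computed by the exterior derivative of the half space in
every chart (`inChart_dM`, from the naturality of the exterior derivative); the integral of a form
supported in two charts is the same in both (`chartIntegral_eq`); and Stokes' theorem holds on the
half space (`integral_extDerivWithin_halfSpace`, from the divergence theorem on a box). The
integrals over `M` and `∂M` are defined through one fixed partition of unity `ρ`. Writing
`d ω = ∑_j d (ρ_j ω)` and changing charts,
`∑_i ∫_i ρ_i d ω = ∑_j ∑_i ∫_j ρ_i d (ρ_j ω) = ∑_j ∫_j d (ρ_j ω)`,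
where `∫_i` is the integral in the chart at `i`. So no Leibniz rule is needed.
-/

set_option linter.unusedSectionVars false

namespace StatStokes

/-! ### Forms and the exterior derivative in charts -/

section Charts

variable {n : ℕ} {M : Type*} [TopologicalSpace M]
  [ChartedSpace (EuclideanHalfSpace (n + 1)) M] [IsManifold (𝓡∂ (n + 1)) ∞ M]

local notation "𝓘∂" => 𝓡∂ (n + 1)

/-- The part of a chart that another chart covers is open in the half space. -/
theorem overlap_mem_nhdsWithin {i j m : M} (hi : m ∈ (extChartAt 𝓘∂ i).source)
    (hj : m ∈ (extChartAt 𝓘∂ j).source) :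
    (extChartAt 𝓘∂ i).target ∩ (extChartAt 𝓘∂ i).symm ⁻¹' (extChartAt 𝓘∂ j).source ∈
      𝓝[range 𝓘∂] (extChartAt 𝓘∂ i m) := by
  refine Filter.inter_mem (extChartAt_target_mem_nhdsWithin' hi) ?_
  have h := extChartAt_preimage_mem_nhdsWithin' (I := 𝓘∂) (s := univ) hi
    (by simpa [nhdsWithin_univ] using (isOpen_extChartAt_source (I := 𝓘∂) j).mem_nhds hj)
  simpa using h

theorem inChart_extChartAt {k : ℕ} (i : M) (η : DForm n M k) {m : M}
    (hi : m ∈ (extChartAt 𝓘∂ i).source) :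
    inChart i η (extChartAt 𝓘∂ i m) =
      (η m).compContinuousLinearMap (tangentCoordChange 𝓘∂ i m m) := by
  simp only [inChart, (extChartAt 𝓘∂ i).left_inv hi]

/-- The expressions of a form in two charts are related by the pullback along the change of
coordinates. -/
theorem inChart_eq_comp {k : ℕ} (i j : M) (η : DForm n M k) {m : M}
    (hi : m ∈ (extChartAt 𝓘∂ i).source) (hj : m ∈ (extChartAt 𝓘∂ j).source) :
    inChart i η (extChartAt 𝓘∂ i m) =
      (inChart j η (extChartAt 𝓘∂ j m)).compContinuousLinearMap
        (tangentCoordChange 𝓘∂ i j m) := by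
  rw [inChart_extChartAt i η hi, inChart_extChartAt j η hj]
  ext v
  simp only [ContinuousAlternatingMap.compContinuousLinearMap_apply]
  congr 1
  funext l
  exact (tangentCoordChange_comp ⟨⟨hi, hj⟩, mem_extChartAt_source m⟩).symm

theorem extDerivWithin_congr_nhdsWithin {E F : Type*} [NormedAddCommGroup E] [NormedSpace ℝ E]
    [NormedAddCommGroup F] [NormedSpace ℝ F] {k : ℕ} (η : E → E [⋀^Fin k]→L[ℝ] F) {s t : Set E}
    {x : E} (h : 𝓝[s] x = 𝓝[t] x) : extDerivWithin η s x = extDerivWithin η t x := by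
  rw [extDerivWithin, extDerivWithin, fderivWithin_congr_set (nhdsWithin_eq_iff_eventuallyEq.1 h)]

theorem IsSmoothForm.differentiableWithinAt {k : ℕ} {η : DForm n M k} (hη : IsSmoothForm η)
    (m : M) : DifferentiableWithinAt ℝ (inChart m η) (range 𝓘∂) (extChartAt 𝓘∂ m m) :=
  (((hη m).differentiableOn (by simp)) _ (mem_extChartAt_target m)).mono_of_mem_nhdsWithin
    (extChartAt_target_mem_nhdsWithin m)

/-- In every chart, `d_M` is the exterior derivative of the half space. By definition `d_M η` at `m`
is computed in the preferred chart at `m`; the exterior derivative commutes with the pullback along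
the change of coordinates to the chart at `i`. -/
theorem inChart_dM {k : ℕ} {η : DForm n M k} (hη : IsSmoothForm η) (i : M)
    {y : EuclideanSpace ℝ (Fin (n + 1))} (hy : y ∈ (extChartAt 𝓘∂ i).target) :
    inChart i (dM η) y = extDerivWithin (inChart i η) (range 𝓘∂) y := by
  obtain ⟨m, hm, rfl⟩ : ∃ m ∈ (extChartAt 𝓘∂ i).source, extChartAt 𝓘∂ i m = y :=
    ⟨_, (extChartAt 𝓘∂ i).map_target hy, (extChartAt 𝓘∂ i).right_inv hy⟩
  have hmm := mem_extChartAt_source (I := 𝓘∂) m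
  -- `s` is the part of the chart at `i` that the chart at `m` covers, open in the half space.
  set s := (extChartAt 𝓘∂ i).target ∩ (extChartAt 𝓘∂ i).symm ⁻¹' (extChartAt 𝓘∂ m).source
  have hsr : s ⊆ range 𝓘∂ := inter_subset_left.trans (extChartAt_target_subset_range i)
  have hsn : ∀ z ∈ s, s ∈ 𝓝[range 𝓘∂] z := fun z hz => by
    have := overlap_mem_nhdsWithin ((extChartAt 𝓘∂ i).map_target hz.1) hz.2
    rwa [(extChartAt 𝓘∂ i).right_inv hz.1] at this
  have hnn : ∀ z ∈ s, 𝓝[s] z = 𝓝[range 𝓘∂] z := fun z hz =>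
    le_antisymm (nhdsWithin_mono _ hsr) (nhdsWithin_le_of_mem (hsn z hz))
  have hsu : UniqueDiffOn ℝ s := fun z hz =>
    (𝓘∂.uniqueDiffOn z (hsr hz)).mono_nhds (hnn z hz).ge
  have hys : extChartAt 𝓘∂ i m ∈ s := ⟨hy, by rwa [mem_preimage, (extChartAt 𝓘∂ i).left_inv hm]⟩
  have hyc : extChartAt 𝓘∂ i m ∈ closure (interior s) := by
    obtain ⟨U, hU, hyU, hUs⟩ := mem_nhdsWithin.1 (hsn _ hys)
    have h1 : U ∩ interior (range 𝓘∂) ⊆ interior s :=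
      interior_maximal ((inter_subset_inter_right _ interior_subset).trans hUs)
        (hU.inter isOpen_interior)
    exact closure_mono h1 (hU.inter_closure ⟨hyU, 𝓘∂.range_subset_closure_interior (hsr hys)⟩)
  have hf : ContDiffOn ℝ ∞ (extChartAt 𝓘∂ m ∘ (extChartAt 𝓘∂ i).symm) s := by
    have := contDiffOn_ext_coord_change (I := 𝓘∂) (n := ∞) m i
    rwa [PartialEquiv.trans_source, PartialEquiv.symm_source] at this
  have hfd : ∀ z ∈ s, fderivWithin ℝ (extChartAt 𝓘∂ m ∘ (extChartAt 𝓘∂ i).symm) s z =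
      tangentCoordChange 𝓘∂ i m ((extChartAt 𝓘∂ i).symm z) := fun z hz => by
    have := hasFDerivWithinAt_tangentCoordChange (I := 𝓘∂)
      ⟨(extChartAt 𝓘∂ i).map_target hz.1, hz.2⟩
    rw [(extChartAt 𝓘∂ i).right_inv hz.1] at this
    exact (this.mono hsr).fderivWithin (hsu z hz)
  have hmap : MapsTo (extChartAt 𝓘∂ m ∘ (extChartAt 𝓘∂ i).symm) s (range 𝓘∂) :=
    fun z _ => extChartAt_target_subset_range m ((extChartAt 𝓘∂ m).map_source ‹z ∈ s›.2)
  have hfy : (extChartAt 𝓘∂ m ∘ (extChartAt 𝓘∂ i).symm) (extChartAt 𝓘∂ i m) =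
      extChartAt 𝓘∂ m m := by rw [Function.comp_apply, (extChartAt 𝓘∂ i).left_inv hm]
  have key := extDerivWithin_pullback (hfy ▸ hη.differentiableWithinAt m) (hf _ hys) (by simp; norm_cast) hsu hyc hys hmap
  rw [hfd _ hys, hfy, (extChartAt 𝓘∂ i).left_inv hm] at key
  rw [inChart_extChartAt i _ hm, dM, ← key, ← extDerivWithin_congr_nhdsWithin _ (hnn _ hys)]
  refine extDerivWithin_congr' (fun z hz => ?_) hys
  have h2 := inChart_eq_comp i m η ((extChartAt 𝓘∂ i).map_target hz.1) hz.2
  rw [(extChartAt 𝓘∂ i).right_inv hz.1] at h2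
  rw [hfd z hz]
  exact h2.symm

theorem IsSmoothForm.dM {k : ℕ} {η : DForm n M k} (hη : IsSmoothForm η) :
    IsSmoothForm (dM η) := by
  intro i
  have h1 : ContDiffOn ℝ ∞ (fun y => ContinuousAlternatingMap.alternatizeUncurryFinCLM ℝ
      (EuclideanSpace ℝ (Fin (n + 1))) ℝ
      (fderivWithin ℝ (inChart i η) (extChartAt 𝓘∂ i).target y)) (extChartAt 𝓘∂ i).target :=
    (ContinuousLinearMap.contDiff _).comp_contDiffOn
      ((hη i).fderivWithin (uniqueDiffOn_extChartAt_target i) (by simp))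
  refine h1.congr fun y hy => ?_
  have h2 : 𝓝[range 𝓘∂] y = 𝓝[(extChartAt 𝓘∂ i).target] y :=
    le_antisymm (nhdsWithin_le_of_mem (extChartAt_target_mem_nhdsWithin_of_mem hy))
      (nhdsWithin_mono _ (extChartAt_target_subset_range i))
  rw [inChart_dM hη i hy, extDerivWithin_congr_nhdsWithin _ h2]
  rfl

theorem inChart_add {k : ℕ} (i : M) (η ζ : DForm n M k) :
    inChart i (η + ζ) = inChart i η + inChart i ζ := rfl

theorem inChart_zero {k : ℕ} (i : M) : inChart i (0 : DForm n M k) = 0 := rfl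

theorem inChart_sum {k : ℕ} {ι : Type*} (s : Finset ι) (i : M) (η : ι → DForm n M k) :
    inChart i (∑ j ∈ s, η j) = ∑ j ∈ s, inChart i (η j) :=
  map_sum (⟨⟨inChart i, inChart_zero i⟩, inChart_add i⟩ :
    DForm n M k →+ (EuclideanSpace ℝ (Fin (n + 1)) →
      EuclideanSpace ℝ (Fin (n + 1)) [⋀^Fin k]→L[ℝ] ℝ)) η s

theorem IsSmoothForm.zero {k : ℕ} : IsSmoothForm (0 : DForm n M k) := fun i => by
  rw [inChart_zero]
  exact contDiffOn_const

theorem IsSmoothForm.add {k : ℕ} {η ζ : DForm n M k} (hη : IsSmoothForm η)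
    (hζ : IsSmoothForm ζ) : IsSmoothForm (η + ζ) := fun i => (hη i).add (hζ i)

theorem IsSmoothForm.smul {k : ℕ} {η : DForm n M k} (hη : IsSmoothForm η) {g : M → ℝ}
    (hg : ContMDiff 𝓘∂ 𝓘(ℝ) ∞ g) : IsSmoothForm (g • η) := fun i => by
  have h1 : ContDiffOn ℝ ∞ (g ∘ (extChartAt 𝓘∂ i).symm) (extChartAt 𝓘∂ i).target :=
    (hg.comp_contMDiffOn (contMDiffOn_extChartAt_symm i)).contDiffOn
  exact h1.smul (hη i)

theorem IsSmoothForm.sum {k : ℕ} {ι : Type*} {s : Finset ι} {η : ι → DForm n M k}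
    (hη : ∀ j ∈ s, IsSmoothForm (η j)) : IsSmoothForm (∑ j ∈ s, η j) :=
  Finset.sum_induction _ _ (fun _ _ => IsSmoothForm.add) IsSmoothForm.zero hη

theorem dM_zero {k : ℕ} : dM (0 : DForm n M k) = 0 := by
  funext m
  simp only [dM, inChart_zero, extDerivWithin, Pi.zero_apply]
  rw [fderivWithin_zero]
  simp [← ContinuousAlternatingMap.alternatizeUncurryFinCLM_apply]

theorem dM_add {k : ℕ} {η ζ : DForm n M k} (hη : IsSmoothForm η) (hζ : IsSmoothForm ζ) :
    dM (η + ζ) = dM η + dM ζ := by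
  funext m
  exact extDerivWithin_add (𝓘∂.uniqueDiffOn _ (mem_range_self _))
    (hη.differentiableWithinAt m) (hζ.differentiableWithinAt m)

theorem dM_sum {k : ℕ} {ι : Type*} (s : Finset ι) {η : ι → DForm n M k}
    (hη : ∀ j ∈ s, IsSmoothForm (η j)) : dM (∑ j ∈ s, η j) = ∑ j ∈ s, dM (η j) := by
  classical
  induction s using Finset.induction_on with
  | empty => simpa using dM_zero
  | insert a s ha ih =>
    rw [Finset.sum_insert ha, Finset.sum_insert ha,
      dM_add (hη a (by simp)) (IsSmoothForm.sum fun j hj => hη j (by simp [hj])),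
      ih fun j hj => hη j (by simp [hj])]

/-- The exterior derivative does not enlarge supports. -/
theorem dM_eq_zero {k : ℕ} {η : DForm n M k} {K : Set M} (hK : IsClosed K)
    (hη : ∀ m ∉ K, η m = 0) {m : M} (hm : m ∉ K) : dM η m = 0 := by
  have h1 : inChart m η =ᶠ[𝓝[range 𝓘∂] (extChartAt 𝓘∂ m m)] inChart m 0 := by
    have h2 := extChartAt_preimage_mem_nhdsWithin' (I := 𝓘∂) (s := univ) (t := Kᶜ)
      (mem_extChartAt_source m) (by simpa [nhdsWithin_univ] using hK.isOpen_compl.mem_nhds hm)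
    simp only [preimage_univ, univ_inter] at h2
    filter_upwards [h2] with y hy
    simp only [inChart, hη _ hy, Pi.zero_apply]
  have h3 := h1.extDerivWithin_eq_of_mem (mem_range_self _)
  have h4 := congrFun (dM_zero (n := n) (M := M) (k := k)) m
  rw [dM] at h4 ⊢
  rw [h3, h4, Pi.zero_apply]

theorem IsSmoothFamily.isSmoothForm {V A : Type*} [NormedAddCommGroup V] [NormedSpace ℝ V]
    [TopologicalSpace A] [ChartedSpace V A] {k : ℕ} {θ : A → DForm n M k}
    (hθ : IsSmoothFamily (V := V) θ) (a : A) : IsSmoothForm (θ a) := fun i => by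
  have h1 : ContMDiffOn 𝓘(ℝ, EuclideanSpace ℝ (Fin (n + 1)))
      ((𝓘(ℝ, EuclideanSpace ℝ (Fin (n + 1)))).prod 𝓘(ℝ, V)) ∞
      (fun y : EuclideanSpace ℝ (Fin (n + 1)) => (y, a)) (extChartAt 𝓘∂ i).target :=
    contMDiffOn_id.prodMk contMDiffOn_const
  exact ((hθ i).comp h1 fun y hy => ⟨hy, mem_univ _⟩).contDiffOn

/-- By conservation of flux `exp_a d exp_b⁻¹ = exp_a exp_b⁻¹ d`, and the mean over `b` of
`exp_a exp_b⁻¹` is the identity: the statistical derivative is the exterior derivative. -/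
theorem statDeriv_eq_dM {A : Type*} [MeasurableSpace A] {f : M → Measure A}
    {e : A → FormAut n M} {k : ℕ} (hflux : ∀ a, ConservesFlux (e a) k)
    (hnorm : IsNormalised f e (k + 1)) (a : A) {η : DForm n M k} (hη : IsSmoothForm η) :
    statDeriv f e a η = dM η := by
  have h1 : ∀ b, dM ((e b).inv k η) = (e b).inv (k + 1) (dM η) := fun b => by
    have h2 := hflux b _ ((e b).smooth_inv k η hη)
    rw [(e b).op_inv k η hη] at h2
    rw [h2, (e b).inv_op _ _ ((e b).smooth_inv k η hη).dM]
  funext m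
  simp only [statDeriv, h1]
  exact (hnorm a _ hη.dM m).2

end Charts

/-! ### Change of variables between charts -/

section ChangeOfVariables

variable {n : ℕ} {M : Type*} [TopologicalSpace M]
  [ChartedSpace (EuclideanHalfSpace (n + 1)) M] [IsManifold (𝓡∂ (n + 1)) ∞ M]

local notation "𝓘∂" => 𝓡∂ (n + 1)

theorem measurableSet_overlap (i : M) {U : Set M} (hU : IsOpen U) :
    MeasurableSet ((extChartAt 𝓘∂ i).target ∩ (extChartAt 𝓘∂ i).symm ⁻¹' U) := by
  have h1 := (chartAt (EuclideanHalfSpace (n + 1)) i).symm.isOpen_inter_preimage hU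
  have h2 : (extChartAt 𝓘∂ i).target ∩ (extChartAt 𝓘∂ i).symm ⁻¹' U =
      (𝓘∂.symm ⁻¹' ((chartAt (EuclideanHalfSpace (n + 1)) i).symm.source ∩
        (chartAt (EuclideanHalfSpace (n + 1)) i).symm ⁻¹' U)) ∩ range 𝓘∂ := by
    rw [extChartAt_target, preimage_inter, inter_right_comm]
    rfl
  rw [h2]
  exact (h1.preimage 𝓘∂.continuous_symm).measurableSet.inter 𝓘∂.isClosed_range.measurableSet

theorem measurableSet_extChartAt_target (i : M) : MeasurableSet (extChartAt 𝓘∂ i).target := by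
  simpa using measurableSet_overlap i isOpen_univ

/-- A form of top degree is multiplied by the determinant under a linear change of variables. -/
theorem alternating_comp_eq_det_mul (g : EuclideanSpace ℝ (Fin (n + 1)) [⋀^Fin (n + 1)]→L[ℝ] ℝ)
    (D : EuclideanSpace ℝ (Fin (n + 1)) →L[ℝ] EuclideanSpace ℝ (Fin (n + 1))) :
    (g.compContinuousLinearMap D) (fun j => EuclideanSpace.single j 1) =
      D.det * g fun j => EuclideanSpace.single j 1 := by
  set b := (EuclideanSpace.basisFun (Fin (n + 1)) ℝ).toBasis with hb
  have hbv : (fun j => EuclideanSpace.single j (1 : ℝ)) = b := by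
    funext j
    simp [hb]
  have h1 := g.toAlternatingMap.eq_smul_basis_det b
  have h2 : ∀ v, g v = g b * b.det v := fun v => DFunLike.congr_fun h1 v
  rw [ContinuousAlternatingMap.compContinuousLinearMap_apply, hbv, h2]
  have h3 : b.det (D ∘ b) = LinearMap.det (D : EuclideanSpace ℝ (Fin (n + 1)) →ₗ[ℝ] _) * b.det b :=
    b.det_comp _ _
  rw [h3, b.det_self, mul_one, mul_comm]

theorem det_tangentCoordChange (i j : M) {m : M} (hi : m ∈ (extChartAt 𝓘∂ i).source)
    (hj : m ∈ (extChartAt 𝓘∂ j).source) :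
    (tangentCoordChange 𝓘∂ i m m).det =
      (tangentCoordChange 𝓘∂ j m m).det * (tangentCoordChange 𝓘∂ i j m).det := by
  have h1 : tangentCoordChange 𝓘∂ i m m =
      (tangentCoordChange 𝓘∂ j m m).comp (tangentCoordChange 𝓘∂ i j m) := by
    ext1 v
    exact (tangentCoordChange_comp ⟨⟨hi, hj⟩, mem_extChartAt_source m⟩).symm
  rw [h1]
  exact LinearMap.det_comp _ _

theorem real_sign_mul (x y : ℝ) : Real.sign (x * y) = Real.sign x * Real.sign y := by
  rcases lt_trichotomy x 0 with hx | hx | hx <;> rcases lt_trichotomy y 0 with hy | hy | hy <;>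
    simp [hx, hy, Real.sign_of_neg, Real.sign_of_pos, mul_pos_of_neg_of_neg, mul_neg_of_neg_of_pos,
      mul_neg_of_pos_of_neg]

theorem real_sign_mul_self (x : ℝ) : Real.sign x * x = |x| := by
  rcases lt_trichotomy x 0 with hx | hx | hx
  · rw [Real.sign_of_neg hx, abs_of_neg hx]; ring
  · simp [hx]
  · rw [Real.sign_of_pos hx, abs_of_pos hx]; ring

/-- The integral over the chart at `i` of a form of top degree, with the sign of the chart. -/
noncomputable def chartIntegral (o : MOrientation n M) (i : M) (η : DForm n M (n + 1)) : ℝ :=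
  ∫ y in (extChartAt 𝓘∂ i).target, o.chartSign i ((extChartAt 𝓘∂ i).symm y) *
    inChart i η y fun j => EuclideanSpace.single j 1

theorem chartIntegral_eq_overlap (o : MOrientation n M) (i j : M) {η : DForm n M (n + 1)}
    (hj : ∀ m ∉ (extChartAt 𝓘∂ j).source, η m = 0) :
    chartIntegral o i η = ∫ y in (extChartAt 𝓘∂ i).target ∩
      (extChartAt 𝓘∂ i).symm ⁻¹' (extChartAt 𝓘∂ j).source,
        o.chartSign i ((extChartAt 𝓘∂ i).symm y) *
          inChart i η y fun j => EuclideanSpace.single j 1 := by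
  refine setIntegral_eq_of_subset_of_forall_sdiff_eq_zero (measurableSet_extChartAt_target i)
    inter_subset_left ?_
  rintro y ⟨hy, hy'⟩
  have h1 : (extChartAt 𝓘∂ i).symm y ∉ (extChartAt 𝓘∂ j).source := fun h => hy' ⟨hy, h⟩
  simp only [inChart, hj _ h1]
  simp

/-- Change of variables: for a form supported in two charts, the integral does not depend on the
chart. The signs of the two charts differ by the sign of the Jacobian determinant `det D`, which
turns the `|det D|` of the change of variables formula into the `det D` by which the form is
transformed. No regularity of the form is needed. -/
theorem chartIntegral_eq (o : MOrientation n M) (i j : M) {η : DForm n M (n + 1)}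
    (hi : ∀ m ∉ (extChartAt 𝓘∂ i).source, η m = 0)
    (hj : ∀ m ∉ (extChartAt 𝓘∂ j).source, η m = 0) :
    chartIntegral o i η = chartIntegral o j η := by
  rw [chartIntegral_eq_overlap o i j hj, chartIntegral_eq_overlap o j i hi]
  set s := (extChartAt 𝓘∂ i).target ∩ (extChartAt 𝓘∂ i).symm ⁻¹' (extChartAt 𝓘∂ j).source
  set f := extChartAt 𝓘∂ j ∘ (extChartAt 𝓘∂ i).symm with hf
  have hs : MeasurableSet s := measurableSet_overlap i (isOpen_extChartAt_source j)
  have himg : (extChartAt 𝓘∂ j).target ∩ (extChartAt 𝓘∂ j).symm ⁻¹' (extChartAt 𝓘∂ i).source =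
      f '' s := by
    ext z
    constructor
    · rintro ⟨hz, hz'⟩
      refine ⟨extChartAt 𝓘∂ i ((extChartAt 𝓘∂ j).symm z),
        ⟨(extChartAt 𝓘∂ i).map_source hz', ?_⟩, ?_⟩
      · rw [mem_preimage, (extChartAt 𝓘∂ i).left_inv hz']
        exact (extChartAt 𝓘∂ j).map_target hz
      · rw [hf, Function.comp_apply, (extChartAt 𝓘∂ i).left_inv hz',
          (extChartAt 𝓘∂ j).right_inv hz]
    · rintro ⟨y, ⟨hy, hy'⟩, rfl⟩
      refine ⟨(extChartAt 𝓘∂ j).map_source hy', ?_⟩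
      rw [mem_preimage, hf, Function.comp_apply, (extChartAt 𝓘∂ j).left_inv hy']
      exact (extChartAt 𝓘∂ i).map_target hy
  have hinj : InjOn f s := by
    rintro y ⟨hy, hy'⟩ z ⟨hz, hz'⟩ h
    exact (extChartAt 𝓘∂ i).symm.injOn hy hz ((extChartAt 𝓘∂ j).injOn hy' hz' h)
  have hder : ∀ y ∈ s, HasFDerivWithinAt f
      (tangentCoordChange 𝓘∂ i j ((extChartAt 𝓘∂ i).symm y)) s y := fun y hy => by
    have := hasFDerivWithinAt_tangentCoordChange (I := 𝓘∂)
      ⟨(extChartAt 𝓘∂ i).map_target hy.1, hy.2⟩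
    rw [(extChartAt 𝓘∂ i).right_inv hy.1] at this
    exact this.mono (inter_subset_left.trans (extChartAt_target_subset_range i))
  rw [himg, integral_image_eq_integral_abs_det_fderiv_smul volume hs hder hinj]
  refine setIntegral_congr_fun hs fun y hy => ?_
  obtain ⟨m, hm, rfl⟩ : ∃ m ∈ (extChartAt 𝓘∂ i).source, extChartAt 𝓘∂ i m = y :=
    ⟨_, (extChartAt 𝓘∂ i).map_target hy.1, (extChartAt 𝓘∂ i).right_inv hy.1⟩
  have hmj : m ∈ (extChartAt 𝓘∂ j).source := by
    have := hy.2
    rwa [mem_preimage, (extChartAt 𝓘∂ i).left_inv hm] at this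
  simp only [hf, Function.comp_apply, (extChartAt 𝓘∂ i).left_inv hm,
    (extChartAt 𝓘∂ j).left_inv hmj]
  rw [inChart_eq_comp i j η hm hmj, alternating_comp_eq_det_mul, MOrientation.chartSign,
    MOrientation.chartSign, det_tangentCoordChange i j hm hmj, real_sign_mul, smul_eq_mul,
    ← real_sign_mul_self]
  ring

theorem continuousOn_chartSign (o : MOrientation n M) (i : M) :
    ContinuousOn (fun y => o.chartSign i ((extChartAt 𝓘∂ i).symm y)) (extChartAt 𝓘∂ i).target :=
  (o.continuousOn_sign i).comp (continuousOn_extChartAt_symm i) (extChartAt 𝓘∂ i).symm.mapsTo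

/-- The value `0`, which `Real.sign` takes at a singular matrix, is harmless here: only the
discreteness of the set of values is used. -/
theorem chartSign_values (o : MOrientation n M) (i m : M) :
    o.chartSign i m = -1 ∨ o.chartSign i m = 0 ∨ o.chartSign i m = 1 := by
  rw [MOrientation.chartSign]
  rcases o.sign_eq m with h | h <;>
    rcases Real.sign_apply_eq (tangentCoordChange 𝓘∂ i m m).det with h' | h' | h' <;>
    rw [h, h'] <;> norm_num

theorem abs_chartSign_le (o : MOrientation n M) (i m : M) : |o.chartSign i m| ≤ 1 := by
  rcases chartSign_values o i m with h | h | h <;> simp [h]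

/-- The sign of a chart is continuous with discrete values, hence locally constant. -/
theorem chartSign_eventuallyEq (o : MOrientation n M) (i : M)
    {y : EuclideanSpace ℝ (Fin (n + 1))} (hy : y ∈ (extChartAt 𝓘∂ i).target) :
    ∀ᶠ z in 𝓝[range 𝓘∂] y, o.chartSign i ((extChartAt 𝓘∂ i).symm z) =
      o.chartSign i ((extChartAt 𝓘∂ i).symm y) := by
  have h1 := (continuousOn_chartSign o i y hy).mono_of_mem_nhdsWithin
    (extChartAt_target_mem_nhdsWithin_of_mem hy)
  have h2 := Metric.tendsto_nhds.1 h1.tendsto 1 one_pos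
  filter_upwards [h2] with z hz
  rw [Real.dist_eq] at hz
  rcases chartSign_values o i ((extChartAt 𝓘∂ i).symm z) with h | h | h <;>
    rcases chartSign_values o i ((extChartAt 𝓘∂ i).symm y) with h' | h' | h' <;>
    rw [h, h'] at hz ⊢ <;> norm_num at hz

end ChangeOfVariables

/-! ### Stokes' theorem on the half space -/

theorem mem_range_halfSpace {n : ℕ} {y : EuclideanSpace ℝ (Fin (n + 1))} :
    y ∈ range (𝓡∂ (n + 1)) ↔ 0 ≤ y 0 := by
  rw [range_modelWithCornersEuclideanHalfSpace]
  rfl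

/-- Stokes' theorem on the half space, for compactly supported forms. It is the divergence theorem
for the vector field with the components `(-1)^i F(e_0, …, ê_i, …, e_n)` on a box
`[0, R'] × [-R', R']^n` that contains the support: only the face `x_0 = 0` contributes. -/
theorem integral_extDerivWithin_halfSpace {n : ℕ}
    {F : EuclideanSpace ℝ (Fin (n + 1)) → EuclideanSpace ℝ (Fin (n + 1)) [⋀^Fin n]→L[ℝ] ℝ}
    (hF : ContDiffOn ℝ 1 F (range (𝓡∂ (n + 1)))) {R : ℝ}
    (hR : ∀ y ∈ range (𝓡∂ (n + 1)), R ≤ ‖y‖ → F y = 0) :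
    ∫ y in range (𝓡∂ (n + 1)), extDerivWithin F (range (𝓡∂ (n + 1))) y
        (fun j => EuclideanSpace.single j 1) =
      -∫ x : EuclideanSpace ℝ (Fin n), F (bdryPt x) fun j => EuclideanSpace.single j.succ 1 := by
  set H := range (𝓡∂ (n + 1)) with hH
  set B : Fin (n + 1) → EuclideanSpace ℝ (Fin (n + 1)) := fun j => EuclideanSpace.single j 1
    with hB
  have hmem : ∀ y : EuclideanSpace ℝ (Fin (n + 1)), y ∈ H ↔ 0 ≤ y 0 := fun y =>
    mem_range_halfSpace
  set T : (Fin (n + 1) → ℝ) ≃L[ℝ] EuclideanSpace ℝ (Fin (n + 1)) :=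
    (PiLp.continuousLinearEquiv 2 ℝ fun _ : Fin (n + 1) => ℝ).symm with hT
  have hTx : ∀ x, T x = WithLp.toLp 2 x := fun x => rfl
  have hTi : ∀ x i, (T x) i = x i := fun x i => rfl
  have hTB : ∀ i, T (Pi.single i 1) = B i := fun i => by
    rw [hTx, PiLp.toLp_single]
  have hnorm : ∀ (x : Fin (n + 1) → ℝ) i, |x i| ≤ ‖T x‖ := fun x i =>
    PiLp.norm_apply_le (T x) i
  -- The maximum with `1` ensures that the box is not degenerate.
  set R' := max R 1 with hR'
  have hR'0 : 0 < R' := lt_of_lt_of_le one_pos (le_max_right _ _)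
  have hRR : R ≤ R' := le_max_left _ _
  set a : Fin (n + 1) → ℝ := Fin.cons 0 fun _ => -R' with ha
  set b : Fin (n + 1) → ℝ := fun _ => R' with hb
  have ha0 : a 0 = 0 := rfl
  have has : ∀ i : Fin n, a i.succ = -R' := fun i => rfl
  have hab : a ≤ b := fun i => by
    refine Fin.cases ?_ (fun j => ?_) i
    · exact hR'0.le
    · rw [has]; change -R' ≤ R'; linarith
  have hmemT : ∀ x ∈ Icc a b, T x ∈ H := fun x hx => (hmem _).2 (hx.1 0)
  have hout : ∀ x, T x ∈ H → x ∉ Icc a b → R < ‖T x‖ := fun x hx hxI => by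
    have h1 : ∃ i, R' < |x i| := by
      by_contra! hcon
      refine hxI ⟨fun i => ?_, fun i => (abs_le.1 (hcon i)).2⟩
      refine Fin.cases ?_ (fun j => ?_) i
      · exact (hmem _).1 hx
      · exact (abs_le.1 (hcon _)).1
    obtain ⟨i, hi⟩ := h1
    exact hRR.trans_lt (hi.trans_le (hnorm x i))
  have hcd : ContinuousOn (fderivWithin ℝ F H) H :=
    hF.continuousOn_fderivWithin (𝓡∂ (n + 1)).uniqueDiffOn le_rfl
  set f : Fin (n + 1) → (Fin (n + 1) → ℝ) → ℝ :=
    fun i x => (-1) ^ (i : ℕ) * F (T x) (i.removeNth B) with hf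
  set ev : ∀ i : Fin (n + 1), EuclideanSpace ℝ (Fin (n + 1)) [⋀^Fin n]→L[ℝ] ℝ →L[ℝ] ℝ :=
    fun i => ContinuousAlternatingMap.apply ℝ _ ℝ (i.removeNth B) with hev
  set f' : Fin (n + 1) → (Fin (n + 1) → ℝ) → (Fin (n + 1) → ℝ) →L[ℝ] ℝ :=
    fun i x => ((-1 : ℝ) ^ (i : ℕ)) • ((ev i).comp ((fderivWithin ℝ F H (T x)).comp
      (T : (Fin (n + 1) → ℝ) →L[ℝ] _))) with hf'
  have hdiv : ∀ x, ∑ i, f' i x (Pi.single i 1) = extDerivWithin F H (T x) B := fun x => by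
    rw [extDerivWithin, ContinuousAlternatingMap.alternatizeUncurryFin_apply]
    refine Finset.sum_congr rfl fun i _ => ?_
    change (-1 : ℝ) ^ (i : ℕ) • fderivWithin ℝ F H (T x) (T (Pi.single i 1)) (i.removeNth B) = _
    rw [hTB]
    simp
  have hfc : ∀ i, ContinuousOn (f i) (Icc a b) := fun i =>
    continuousOn_const.mul ((ev i).continuous.comp_continuousOn
      (hF.continuousOn.comp T.continuous.continuousOn hmemT))
  have hfd : ∀ x ∈ (pi univ fun i => Ioo (a i) (b i)) \ (∅ : Set (Fin (n + 1) → ℝ)), ∀ i,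
      HasFDerivAt (f i) (f' i x) x := fun x hx i => by
    -- Inside the box the derivative within the half space is the full derivative.
    have h0 : 0 < (T x) 0 := (hx.1 0 (mem_univ _)).1
    have hn : H ∈ 𝓝 (T x) := by
      rw [← mem_interior_iff_mem_nhds, hH, interior_range_modelWithCornersEuclideanHalfSpace]
      exact h0
    have h1 : HasFDerivAt F (fderivWithin ℝ F H (T x)) (T x) :=
      ((hF.differentiableOn one_ne_zero) _ (mem_of_mem_nhds hn)).hasFDerivWithinAt.hasFDerivAt hn
    exact (((ev i).hasFDerivAt.comp _ (h1.comp x T.hasFDerivAt))).const_mul _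
  have hint : IntegrableOn (fun x => ∑ i, f' i x (Pi.single i 1)) (Icc a b) := by
    refine ContinuousOn.integrableOn_compact isCompact_Icc ?_
    refine continuousOn_finsetSum _ fun i _ => ?_
    have h1 : ContinuousOn (fun x => fderivWithin ℝ F H (T x) (T (Pi.single i 1))) (Icc a b) :=
      (hcd.comp T.continuous.continuousOn hmemT).clm_apply continuousOn_const
    exact continuousOn_const.mul ((ev i).continuous.comp_continuousOn h1)
  have key := integral_divergence_of_hasFDerivAt_off_countable' a b hab f f' ∅ countable_empty
    hfc hfd hint
  have hvol := PiLp.volume_preserving_toLp (Fin (n + 1))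
  have hemb : MeasurableEmbedding (WithLp.toLp 2 : (Fin (n + 1) → ℝ) → _) :=
    (MeasurableEquiv.toLp 2 (Fin (n + 1) → ℝ)).measurableEmbedding
  have hL : ∫ y in H, extDerivWithin F H y B =
      ∫ x in Icc a b, ∑ i, f' i x (Pi.single i 1) := by
    rw [← hvol.setIntegral_preimage_emb hemb]
    simp only [hdiv]
    refine (setIntegral_eq_of_subset_of_forall_sdiff_eq_zero ?_ (fun x hx => hmemT x hx) ?_)
    · exact hvol.measurable (𝓡∂ (n + 1)).isClosed_range.measurableSet
    · rintro x ⟨hx, hxI⟩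
      have h1 : F =ᶠ[𝓝[H] (T x)] fun _ => 0 := by
        have h2 : ∀ᶠ y in 𝓝[H] (T x), R < ‖y‖ := nhdsWithin_le_nhds
          ((isOpen_lt continuous_const continuous_norm).mem_nhds (hout x hx hxI))
        filter_upwards [h2, self_mem_nhdsWithin] with y hy hyH using hR y hyH hy.le
      have h3 := h1.extDerivWithin_eq_of_mem hx
      rw [← hTx, h3, extDerivWithin, fderivWithin_fun_const,
        ContinuousAlternatingMap.alternatizeUncurryFin_apply]
      simp
  have hface : ∀ (i : Fin (n + 1)) (x : Fin (n + 1) → ℝ), T x ∈ H → |x i| = R' → f i x = 0 :=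
    fun i x hx hi => by
      simp [hf, hR _ hx (hRR.trans (hi ▸ hnorm x i))]
  have hins : ∀ (i : Fin (n + 1)) (c : ℝ), c ∈ Icc (a i) (b i) →
      ∀ x ∈ Icc (a ∘ i.succAbove) (b ∘ i.succAbove), T (i.insertNth c x) ∈ H :=
    fun i c hc x hx => hmemT _ (Fin.insertNth_mem_Icc.2 ⟨hc, hx⟩)
  rw [hL, key, Fin.sum_univ_succ, Finset.sum_eq_zero, add_zero,
    setIntegral_eq_zero_of_forall_eq_zero, zero_sub]
  · congr 1
    rw [setIntegral_eq_integral_of_forall_compl_eq_zero,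
      ← (PiLp.volume_preserving_toLp (Fin n)).integral_comp
        (MeasurableEquiv.toLp 2 (Fin n → ℝ)).measurableEmbedding]
    · refine integral_congr_ae (Filter.Eventually.of_forall fun x => ?_)
      simp only [hf, Fin.val_zero, pow_zero, one_mul, hTx]
      rw [ha0, Fin.insertNth_zero]
      rfl
    · intro x hx
      have h1 : T ((0 : Fin (n + 1)).insertNth (a 0) x) ∈ H := (hmem _).2 (by
        rw [hTi, Fin.insertNth_apply_same, ha0])
      have h2 := hout _ h1 fun h => hx (Fin.insertNth_mem_Icc.1 h).2
      simp only [hf, hR _ h1 h2.le]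
      simp
  · intro x hx
    refine hface _ _ (hins _ _ (right_mem_Icc.2 (hab _)) x hx) ?_
    rw [Fin.insertNth_apply_same, abs_of_pos hR'0]
  · intro i _
    rw [setIntegral_eq_zero_of_forall_eq_zero, setIntegral_eq_zero_of_forall_eq_zero, sub_zero]
    · intro x hx
      refine hface _ _ (hins _ _ (left_mem_Icc.2 (hab _)) x hx) ?_
      rw [Fin.insertNth_apply_same, has, abs_neg, abs_of_pos hR'0]
    · intro x hx
      refine hface _ _ (hins _ _ (right_mem_Icc.2 (hab _)) x hx) ?_
      rw [Fin.insertNth_apply_same, abs_of_pos hR'0]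

/-! ### Stokes' theorem in a chart -/

section LocalStokes

variable {n : ℕ} {M : Type*} [TopologicalSpace M]
  [ChartedSpace (EuclideanHalfSpace (n + 1)) M] [IsManifold (𝓡∂ (n + 1)) ∞ M]

local notation "𝓘∂" => 𝓡∂ (n + 1)

/-- The integral over the boundary part of the chart at `i` of a form of degree `dim M - 1`, with
the sign of the boundary orientation. -/
noncomputable def chartIntegralBdry (o : MOrientation n M) (i : M) (η : DForm n M n) : ℝ :=
  ∫ x in {x : EuclideanSpace ℝ (Fin n) | bdryPt x ∈ (extChartAt 𝓘∂ i).target},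
    -o.chartSign i ((extChartAt 𝓘∂ i).symm (bdryPt x)) *
      inChart i η (bdryPt x) fun j => EuclideanSpace.single j.succ 1

theorem continuous_bdryPt : Continuous (bdryPt : EuclideanSpace ℝ (Fin n) → _) := by
  refine (PiLp.continuous_toLp 2 _).comp (continuous_pi fun i => ?_)
  refine Fin.cases ?_ (fun j => ?_) i
  · exact continuous_const
  · exact (continuous_apply j).comp (PiLp.continuous_ofLp 2 _)

theorem measurableSet_bdry_target (i : M) :
    MeasurableSet {x : EuclideanSpace ℝ (Fin n) | bdryPt x ∈ (extChartAt 𝓘∂ i).target} :=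
  continuous_bdryPt.measurable (measurableSet_extChartAt_target i)

theorem inChart_eq_zero {k : ℕ} {i : M} {η : DForm n M k} {K : Set M}
    (hη : ∀ m ∉ K, η m = 0) {y : EuclideanSpace ℝ (Fin (n + 1))}
    (hy : y ∈ (extChartAt 𝓘∂ i).target) (hyK : y ∉ extChartAt 𝓘∂ i '' K) :
    inChart i η y = 0 := by
  have h1 : (extChartAt 𝓘∂ i).symm y ∉ K := fun h =>
    hyK ⟨_, h, (extChartAt 𝓘∂ i).right_inv hy⟩
  rw [inChart, hη _ h1]
  rfl

theorem isCompact_image_extChartAt {i : M} {K : Set M} (hK : IsCompact K)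
    (hKi : K ⊆ (extChartAt 𝓘∂ i).source) : IsCompact (extChartAt 𝓘∂ i '' K) :=
  hK.image_of_continuousOn ((continuousOn_extChartAt i).mono hKi)

theorem image_extChartAt_subset {i : M} {K : Set M}
    (hKi : K ⊆ (extChartAt 𝓘∂ i).source) : extChartAt 𝓘∂ i '' K ⊆ (extChartAt 𝓘∂ i).target :=
  ((extChartAt 𝓘∂ i).mapsTo.mono_left hKi).image_subset

/-- Stokes' theorem for forms with compact support in one chart. The form of the chart, times the
locally constant sign, extends by zero to a form `F` on the whole half space. -/
theorem chartIntegral_dM (o : MOrientation n M) {j : M} {ζ : DForm n M n} (hζ : IsSmoothForm ζ)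
    {K : Set M} (hK : IsCompact K) (hKj : K ⊆ (extChartAt 𝓘∂ j).source)
    (hζK : ∀ m ∉ K, ζ m = 0) : chartIntegral o j (dM ζ) = chartIntegralBdry o j ζ := by
  set T := (extChartAt 𝓘∂ j).target with hT
  set s : EuclideanSpace ℝ (Fin (n + 1)) → ℝ :=
    fun y => o.chartSign j ((extChartAt 𝓘∂ j).symm y) with hs
  set F := T.indicator (fun y => s y • inChart j ζ y) with hF
  have hTr : T ⊆ range 𝓘∂ := extChartAt_target_subset_range j
  have hTn : ∀ y ∈ T, T ∈ 𝓝[range 𝓘∂] y := fun y hy =>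
    extChartAt_target_mem_nhdsWithin_of_mem hy
  have hcK := isCompact_image_extChartAt hK hKj
  have hFK : ∀ y ∉ extChartAt 𝓘∂ j '' K, F y = 0 := fun y hy => by
    by_cases hyT : y ∈ T
    · rw [hF, indicator_of_mem hyT, inChart_eq_zero hζK hyT hy, smul_zero]
    · exact indicator_of_notMem hyT _
  have hloc : ∀ y ∈ T, F =ᶠ[𝓝[range 𝓘∂] y] fun z => s y • inChart j ζ z := fun y hy => by
    filter_upwards [hTn y hy, chartSign_eventuallyEq o j hy] with z hz hz'
    rw [hF, indicator_of_mem hz]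
    simp only [hs, hz']
  have hloc' : ∀ y ∉ T, F =ᶠ[𝓝[range 𝓘∂] y] fun _ => 0 := fun y hy => by
    have h1 : (extChartAt 𝓘∂ j '' K)ᶜ ∈ 𝓝 y := hcK.isClosed.isOpen_compl.mem_nhds
      fun h => hy (image_extChartAt_subset hKj h)
    filter_upwards [mem_nhdsWithin_of_mem_nhds h1] with z hz using hFK z hz
  have hFc : ContDiffOn ℝ 1 F (range 𝓘∂) := fun y hy => by
    by_cases hyT : y ∈ T
    · refine ContDiffWithinAt.congr_of_eventuallyEq ?_ (hloc y hyT)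
        ((hloc y hyT).self_of_nhdsWithin hy)
      refine ContDiffWithinAt.mono_of_mem_nhdsWithin ?_ (hTn y hyT)
      exact (((hζ j) y hyT).of_le (by simp)).const_smul _
    · exact contDiffWithinAt_const.congr_of_eventuallyEq (hloc' y hyT)
        ((hloc' y hyT).self_of_nhdsWithin hy)
  obtain ⟨R, hR⟩ := isBounded_iff_forall_norm_le.1 hcK.isBounded
  have key := integral_extDerivWithin_halfSpace hFc (R := R + 1) fun y _ hy =>
    hFK y fun h => by linarith [hR y h]
  have hL : chartIntegral o j (dM ζ) = ∫ y in range 𝓘∂, extDerivWithin F (range 𝓘∂) y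
        (fun j => EuclideanSpace.single j 1) := by
    rw [setIntegral_eq_of_subset_of_forall_sdiff_eq_zero 𝓘∂.isClosed_range.measurableSet hTr]
    · refine setIntegral_congr_fun (measurableSet_extChartAt_target j) fun y hy => ?_
      beta_reduce
      rw [(hloc y hy).extDerivWithin_eq_of_mem (hTr hy),
        extDerivWithin_fun_smul _ _ (𝓘∂.uniqueDiffOn y (hTr hy)), inChart_dM hζ j hy]
      rfl
    · rintro y ⟨hy, hyT⟩
      rw [(hloc' y hyT).extDerivWithin_eq_of_mem hy, extDerivWithin, fderivWithin_fun_const,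
        ContinuousAlternatingMap.alternatizeUncurryFin_apply]
      simp
  rw [hL, key, chartIntegralBdry, ← integral_neg,
    ← setIntegral_eq_integral_of_forall_compl_eq_zero
      (s := {x : EuclideanSpace ℝ (Fin n) | bdryPt x ∈ T})]
  · refine setIntegral_congr_fun (measurableSet_bdry_target j) fun x hx => ?_
    beta_reduce
    rw [hF, indicator_of_mem (show bdryPt x ∈ T from hx), neg_mul]
    rfl
  · intro x hx
    rw [hF, indicator_of_notMem (show bdryPt x ∉ T from hx)]
    simp

theorem integrableOn_chart (o : MOrientation n M) {j : M} {η : DForm n M (n + 1)}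
    (hη : IsSmoothForm η) {K : Set M} (hK : IsCompact K) (hKj : K ⊆ (extChartAt 𝓘∂ j).source)
    (hηK : ∀ m ∉ K, η m = 0) :
    IntegrableOn (fun y => o.chartSign j ((extChartAt 𝓘∂ j).symm y) *
      inChart j η y fun l => EuclideanSpace.single l 1) (extChartAt 𝓘∂ j).target := by
  have h1 : ContinuousOn (fun y => o.chartSign j ((extChartAt 𝓘∂ j).symm y) *
      inChart j η y fun l => EuclideanSpace.single l 1) (extChartAt 𝓘∂ j).target :=
    (continuousOn_chartSign o j).mul ((ContinuousAlternatingMap.apply ℝ _ ℝ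
      fun l => EuclideanSpace.single l 1).continuous.comp_continuousOn (hη j).continuousOn)
  have h2 := (h1.mono (image_extChartAt_subset hKj)).integrableOn_compact
    (isCompact_image_extChartAt hK hKj) (μ := volume)
  refine h2.of_forall_sdiff_eq_zero (measurableSet_extChartAt_target j) ?_
  rintro y ⟨hy, hyK⟩
  rw [inChart_eq_zero hηK hy hyK]
  simp

theorem chartIntegral_sum (o : MOrientation n M) {j : M} {ι : Type*} (s : Finset ι)
    {η : ι → DForm n M (n + 1)} (hη : ∀ l, IsSmoothForm (η l)) {K : Set M} (hK : IsCompact K)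
    (hKj : K ⊆ (extChartAt 𝓘∂ j).source) (hηK : ∀ l, ∀ m ∉ K, η l m = 0) :
    chartIntegral o j (∑ l ∈ s, η l) = ∑ l ∈ s, chartIntegral o j (η l) := by
  unfold chartIntegral
  rw [← integral_finsetSum _ fun l _ => integrableOn_chart o (hη l) hK hKj (hηK l)]
  refine integral_congr_ae (Filter.Eventually.of_forall fun y => ?_)
  simp only [inChart_sum, Finset.sum_apply, ContinuousAlternatingMap.sum_apply, Finset.mul_sum]

end LocalStokes

/-! ### Stokes' theorem on a manifold with boundary -/

section GlobalStokes

variable {n : ℕ} {M : Type*} [TopologicalSpace M] [T2Space M] [SigmaCompactSpace M]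
  [ChartedSpace (EuclideanHalfSpace (n + 1)) M] [IsManifold (𝓡∂ (n + 1)) ∞ M]

local notation "𝓘∂" => 𝓡∂ (n + 1)
local notation "ρ" => chartPartition n M

variable (n) in
/-- The (finitely many) charts that matter for forms supported in the compact set `K`. -/
theorem finite_charts {K : Set M} (hK : IsCompact K) :
    {i : M | (Function.support (ρ i) ∩ K).Nonempty}.Finite :=
  (ρ).locallyFinite.finite_nonempty_inter_compact hK

theorem partition_smul_eq_zero {k : ℕ} {K : Set M} (hK : IsCompact K) {η : DForm n M k}
    (hη : ∀ m ∉ K, η m = 0) {i : M} (hi : i ∉ (finite_charts n hK).toFinset) :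
    (ρ i : M → ℝ) • η = 0 := by
  funext m
  by_cases hm : m ∈ K
  · have h1 : ρ i m = 0 := by
      by_contra h
      exact hi (by simpa using ⟨m, h, hm⟩)
    simp [h1]
  · simp [hη m hm]

theorem integralM_eq_sum (o : MOrientation n M) {K : Set M} (hK : IsCompact K)
    {η : DForm n M (n + 1)} (hη : ∀ m ∉ K, η m = 0) :
    integralM o η = ∑ i ∈ (finite_charts n hK).toFinset,
      chartIntegral o i ((ρ i : M → ℝ) • η) := by
  change ∑ᶠ i : M, chartIntegral o i ((ρ i : M → ℝ) • η) = _
  refine finsum_eq_sum_of_support_subset _ fun i hi => ?_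
  by_contra h
  refine hi ?_
  simp only
  rw [partition_smul_eq_zero hK hη h, chartIntegral, inChart_zero]
  simp

theorem integralBdry_eq_sum (o : MOrientation n M) {K : Set M} (hK : IsCompact K)
    {η : DForm n M n} (hη : ∀ m ∉ K, η m = 0) :
    integralBdry o η = ∑ i ∈ (finite_charts n hK).toFinset,
      chartIntegralBdry o i ((ρ i : M → ℝ) • η) := by
  change ∑ᶠ i : M, chartIntegralBdry o i ((ρ i : M → ℝ) • η) = _
  refine finsum_eq_sum_of_support_subset _ fun i hi => ?_
  by_contra h
  refine hi ?_
  simp only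
  rw [partition_smul_eq_zero hK hη h, chartIntegralBdry, inChart_zero]
  simp

theorem sum_partition_smul {k : ℕ} {K : Set M} (hK : IsCompact K) {η : DForm n M k}
    (hη : ∀ m ∉ K, η m = 0) :
    ∑ i ∈ (finite_charts n hK).toFinset, (ρ i : M → ℝ) • η = η := by
  funext m
  by_cases hm : m ∈ K
  · have h1 : ∑ i ∈ (finite_charts n hK).toFinset, ρ i m = 1 := by
      rw [← (ρ).sum_eq_one (mem_univ m)]
      refine (finsum_eq_sum_of_support_subset _ fun i hi => ?_).symm
      simpa using ⟨m, hi, hm⟩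
    simp only [Finset.sum_apply, Pi.smul_apply']
    rw [← Finset.sum_smul, h1, one_smul]
  · simp [hη m hm]

theorem isCompact_inter_tsupport {K : Set M} (hK : IsCompact K) (i : M) :
    IsCompact (K ∩ tsupport (ρ i)) := hK.inter_right (isClosed_tsupport _)

theorem inter_tsupport_subset (K : Set M) (i : M) :
    K ∩ tsupport (ρ i) ⊆ (extChartAt 𝓘∂ i).source := by
  rw [extChartAt_source]
  exact inter_subset_right.trans (chartPartition_isSubordinate i)

theorem partition_smul_apply_eq_zero {k : ℕ} {K : Set M} {η : DForm n M k}
    (hη : ∀ m ∉ K, η m = 0) (i : M) :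
    ∀ m ∉ K ∩ tsupport (ρ i), ((ρ i : M → ℝ) • η) m = 0 := fun m hm => by
  by_cases h : m ∈ K
  · have h1 : ρ i m = 0 := image_eq_zero_of_notMem_tsupport fun h' => hm ⟨h, h'⟩
    simp [h1]
  · simp [hη m h]

/-- **Stokes' theorem** for smooth forms with compact support. Every form `d(ρ_j ω)` is integrated
with the whole partition of unity; each piece `ρ_i d(ρ_j ω)` is moved from the chart `i` to the
chart `j`, where the pieces add up to `d(ρ_j ω)`, and Stokes' theorem in that chart applies. -/
theorem integralM_dM (o : MOrientation n M) {η : DForm n M n} (hη : IsSmoothForm η)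
    {K : Set M} (hK : IsCompact K) (hηK : ∀ m ∉ K, η m = 0) :
    integralM o (dM η) = integralBdry o η := by
  have hd : ∀ m ∉ K, dM η m = 0 := fun m hm => dM_eq_zero hK.isClosed hηK hm
  rw [integralM_eq_sum o hK hd, integralBdry_eq_sum o hK hηK]
  set S := (finite_charts n hK).toFinset
  have hsm : ∀ j, IsSmoothForm ((ρ j : M → ℝ) • η) := fun j => hη.smul (ρ j).contMDiff
  have hsupp : ∀ j, ∀ m ∉ K ∩ tsupport (ρ j), dM ((ρ j : M → ℝ) • η) m = 0 := fun j m hm =>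
    dM_eq_zero (isCompact_inter_tsupport hK j).isClosed (partition_smul_apply_eq_zero hηK j) hm
  have hsuppK : ∀ j, ∀ m ∉ K, dM ((ρ j : M → ℝ) • η) m = 0 := fun j m hm =>
    hsupp j m fun h => hm h.1
  have hsm' : ∀ i j, IsSmoothForm ((ρ i : M → ℝ) • dM ((ρ j : M → ℝ) • η)) := fun i j =>
    (hsm j).dM.smul (ρ i).contMDiff
  calc ∑ i ∈ S, chartIntegral o i ((ρ i : M → ℝ) • dM η)
      = ∑ i ∈ S, ∑ j ∈ S, chartIntegral o i ((ρ i : M → ℝ) • dM ((ρ j : M → ℝ) • η)) := by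
        refine Finset.sum_congr rfl fun i _ => ?_
        rw [← chartIntegral_sum o S (hsm' i) (isCompact_inter_tsupport hK i)
          (inter_tsupport_subset K i) fun j => partition_smul_apply_eq_zero (hsuppK j) i,
          ← Finset.smul_sum, ← dM_sum S fun j _ => hsm j, sum_partition_smul hK hηK]
    _ = ∑ j ∈ S, ∑ i ∈ S, chartIntegral o j ((ρ i : M → ℝ) • dM ((ρ j : M → ℝ) • η)) := by
        rw [Finset.sum_comm]
        refine Finset.sum_congr rfl fun j _ => Finset.sum_congr rfl fun i _ => ?_
        refine chartIntegral_eq o i j (fun m hm => ?_) fun m hm => ?_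
        · exact partition_smul_apply_eq_zero (hsuppK j) i m fun h =>
            hm (inter_tsupport_subset K i h)
        · rw [Pi.smul_apply', hsupp j m fun h => hm (inter_tsupport_subset K j h), smul_zero]
    _ = ∑ j ∈ S, chartIntegral o j (dM ((ρ j : M → ℝ) • η)) := by
        refine Finset.sum_congr rfl fun j _ => ?_
        rw [← chartIntegral_sum o S (fun i => hsm' i j) (isCompact_inter_tsupport hK j)
          (inter_tsupport_subset K j), sum_partition_smul hK (hsuppK j)]
        intro i m hm
        rw [Pi.smul_apply', hsupp j m hm, smul_zero]
    _ = ∑ j ∈ S, chartIntegralBdry o j ((ρ j : M → ℝ) • η) :=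
        Finset.sum_congr rfl fun j _ => chartIntegral_dM o (hsm j)
          (isCompact_inter_tsupport hK j) (inter_tsupport_subset K j)
          (partition_smul_apply_eq_zero hηK j)

end GlobalStokes

/-! ### Integration over the parameter space -/

/-- Fubini's theorem for the integral of a bounded weight times a functional of a vector-valued
function of two variables. -/
theorem integral_weight_swap {X A V : Type*} [MeasurableSpace X] [MeasurableSpace A]
    [NormedAddCommGroup V] [NormedSpace ℝ V] [CompleteSpace V] {μ : Measure X} [SFinite μ]
    {ν : Measure A} [SFinite ν] {G : X → A → V}
    (hG : Integrable (fun p : X × A => G p.1 p.2) (μ.prod ν)) {w : X → ℝ}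
    (hw : AEStronglyMeasurable w μ) {c : ℝ} (hwc : ∀ x, |w x| ≤ c) (L : V →L[ℝ] ℝ) :
    Integrable (fun a => ∫ x, w x * L (G x a) ∂μ) ν ∧
      ∫ x, w x * L (∫ a, G x a ∂ν) ∂μ = ∫ a, ∫ x, w x * L (G x a) ∂μ ∂ν := by
  have h1 : Integrable (fun p : X × A => w p.1 * L (G p.1 p.2)) (μ.prod ν) :=
    (L.integrable_comp hG).bdd_mul hw.comp_fst (Filter.Eventually.of_forall fun p => hwc p.1)
  refine ⟨h1.integral_prod_right, ?_⟩
  rw [← integral_integral_swap h1]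
  refine integral_congr_ae ?_
  filter_upwards [hG.prod_right_ae] with x hx
  rw [integral_const_mul, L.integral_comp_comm hx]

section Families

variable {n : ℕ} {M : Type*} [TopologicalSpace M]
  [ChartedSpace (EuclideanHalfSpace (n + 1)) M] [IsManifold (𝓡∂ (n + 1)) ∞ M]
  {A : Type*} [MeasurableSpace A]

local notation "𝓘∂" => 𝓡∂ (n + 1)

/-- Integration over `A` commutes with the passage to a chart. No integrability is needed, since
the change of basis in the tangent space is invertible. -/
theorem inChart_integralA (ν : Measure A) {k : ℕ} (θ : A → DForm n M k) (i : M)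
    {y : EuclideanSpace ℝ (Fin (n + 1))} (hy : y ∈ (extChartAt 𝓘∂ i).target) :
    inChart i (integralA ν θ) y = ∫ a, inChart i (θ a) y ∂ν := by
  set m := (extChartAt 𝓘∂ i).symm y with hm
  have hmi : m ∈ (extChartAt 𝓘∂ i).source := (extChartAt 𝓘∂ i).map_target hy
  have hmm := mem_extChartAt_source (I := 𝓘∂) m
  let D : EuclideanSpace ℝ (Fin (n + 1)) ≃L[ℝ] EuclideanSpace ℝ (Fin (n + 1)) :=
    ContinuousLinearEquiv.equivOfInverse (tangentCoordChange 𝓘∂ i m m)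
      (tangentCoordChange 𝓘∂ m i m)
      (fun v => by
        rw [tangentCoordChange_comp ⟨⟨hmi, hmm⟩, hmi⟩, tangentCoordChange_self hmi])
      (fun v => by
        rw [tangentCoordChange_comp ⟨⟨hmm, hmi⟩, hmm⟩, tangentCoordChange_self hmm])
  exact ((D.symm.continuousAlternatingMapCongrLeft (ι := Fin k) (F := ℝ)).integral_comp_comm
    (fun a => θ a m)).symm

end Families

section Fubini

variable {n : ℕ} {M : Type*} [TopologicalSpace M] [T2Space M] [SigmaCompactSpace M]
  [ChartedSpace (EuclideanHalfSpace (n + 1)) M] [IsManifold (𝓡∂ (n + 1)) ∞ M]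
  {A : Type*} [MeasurableSpace A]

local notation "𝓘∂" => 𝓡∂ (n + 1)
local notation "ρ" => chartPartition n M

theorem integralA_eq_zero (ν : Measure A) {k : ℕ} {θ : A → DForm n M k} {K : Set M}
    (hθ : ∀ a, ∀ m ∉ K, θ a m = 0) : ∀ m ∉ K, integralA ν θ m = 0 := fun m hm => by
  simp [integralA, hθ _ m hm]

/-- The weight of the chart at `i` in the integral over `M`: the sign of the chart times the `i`-th
function of the partition of unity. -/
noncomputable def chartWeight (o : MOrientation n M) (i : M)
    (y : EuclideanSpace ℝ (Fin (n + 1))) : ℝ :=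
  o.chartSign i ((extChartAt 𝓘∂ i).symm y) * ρ i ((extChartAt 𝓘∂ i).symm y)

theorem continuousOn_chartWeight (o : MOrientation n M) (i : M) :
    ContinuousOn (chartWeight o i) (extChartAt 𝓘∂ i).target :=
  (continuousOn_chartSign o i).mul
    ((ρ i).contMDiff.continuous.comp_continuousOn (continuousOn_extChartAt_symm i))

theorem abs_chartWeight_le (o : MOrientation n M) (i : M) (y : EuclideanSpace ℝ (Fin (n + 1))) :
    |chartWeight o i y| ≤ 1 := by
  rw [chartWeight, abs_mul]
  refine mul_le_one₀ (abs_chartSign_le o i _) (abs_nonneg _) ?_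
  rw [abs_of_nonneg ((ρ).nonneg i _)]
  exact (ρ).le_one i _

theorem chartIntegral_partition_smul (o : MOrientation n M) (i : M) {K : Set M}
    {η : DForm n M (n + 1)} (hη : ∀ m ∉ K, η m = 0) :
    chartIntegral o i ((ρ i : M → ℝ) • η) =
      ∫ y in extChartAt 𝓘∂ i '' (K ∩ tsupport (ρ i)), chartWeight o i y *
        ContinuousAlternatingMap.apply ℝ _ ℝ (fun j => EuclideanSpace.single j 1)
          (inChart i η y) := by
  rw [chartIntegral, setIntegral_eq_of_subset_of_forall_sdiff_eq_zero
    (measurableSet_extChartAt_target i) (image_extChartAt_subset (inter_tsupport_subset (n := n) K i))]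
  · refine integral_congr_ae (Filter.Eventually.of_forall fun y => ?_)
    exact (mul_assoc _ _ _).symm
  · rintro y ⟨hy, hyK⟩
    rw [inChart_eq_zero (partition_smul_apply_eq_zero hη i) hy hyK]
    simp

theorem chartIntegralBdry_partition_smul (o : MOrientation n M) (i : M) {K : Set M}
    {η : DForm n M n} (hη : ∀ m ∉ K, η m = 0) :
    chartIntegralBdry o i ((ρ i : M → ℝ) • η) =
      ∫ x in bdryPt ⁻¹' (extChartAt 𝓘∂ i '' (K ∩ tsupport (ρ i))), -chartWeight o i (bdryPt x) *
        ContinuousAlternatingMap.apply ℝ _ ℝ (fun j => EuclideanSpace.single j.succ 1)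
          (inChart i η (bdryPt x)) := by
  rw [chartIntegralBdry, setIntegral_eq_of_subset_of_forall_sdiff_eq_zero
    (measurableSet_bdry_target i)
    (preimage_mono (image_extChartAt_subset (inter_tsupport_subset (n := n) K i)))]
  · refine integral_congr_ae (Filter.Eventually.of_forall fun x => ?_)
    refine (mul_assoc _ _ _).symm.trans ?_
    beta_reduce
    rw [neg_mul, chartWeight]
    rfl
  · rintro x ⟨hx, hxK⟩
    rw [inChart_eq_zero (partition_smul_apply_eq_zero hη i) hx hxK]
    simp

theorem isCompact_bdryPt_preimage {C : Set (EuclideanSpace ℝ (Fin (n + 1)))} (hC : IsCompact C) :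
    IsCompact (bdryPt ⁻¹' C) := by
  have h1 : Continuous fun y : EuclideanSpace ℝ (Fin (n + 1)) =>
      (WithLp.toLp 2 fun j : Fin n => y j.succ : EuclideanSpace ℝ (Fin n)) :=
    (PiLp.continuous_toLp 2 _).comp (continuous_pi fun j =>
      (continuous_apply j.succ).comp (PiLp.continuous_ofLp 2 _))
  refine (hC.image h1).of_isClosed_subset (hC.isClosed.preimage continuous_bdryPt) fun x hx => ?_
  exact ⟨bdryPt x, hx, rfl⟩

variable {ν : Measure A} [SigmaFinite ν]

/-- `∫_M` and `∫_A` commute, for families of forms supported in one compact set. -/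
theorem integralM_integralA (o : MOrientation n M) {θ : A → DForm n M (n + 1)} {K : Set M}
    (hK : IsCompact K) (hθ : ∀ a, ∀ m ∉ K, θ a m = 0) (hint : AbsConvergesOnM ν θ) :
    integralM o (integralA ν θ) = ∫ a, integralM o (θ a) ∂ν := by
  simp only [integralM_eq_sum o hK (integralA_eq_zero ν hθ), integralM_eq_sum o hK (hθ _)]
  have key : ∀ i, Integrable (fun a => chartIntegral o i ((ρ i : M → ℝ) • θ a)) ν ∧
      chartIntegral o i ((ρ i : M → ℝ) • integralA ν θ) =
        ∫ a, chartIntegral o i ((ρ i : M → ℝ) • θ a) ∂ν := fun i => by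
    have hC := isCompact_image_extChartAt (n := n) (isCompact_inter_tsupport hK i)
      (inter_tsupport_subset K i)
    have hCT := image_extChartAt_subset (inter_tsupport_subset (n := n) K i)
    have h1 := hint i _ hC hCT
    rw [IntegrableOn, ← Measure.prod_restrict, Measure.restrict_univ] at h1
    have h2 := integral_weight_swap (G := fun y a => inChart i (θ a) y) h1
      (((continuousOn_chartWeight o i).mono hCT).aestronglyMeasurable hC.measurableSet)
      (abs_chartWeight_le o i)
      (ContinuousAlternatingMap.apply ℝ _ ℝ fun j : Fin (n + 1) => EuclideanSpace.single j 1)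
    simp only [chartIntegral_partition_smul o i (hθ _),
      chartIntegral_partition_smul o i (integralA_eq_zero ν hθ)]
    refine ⟨h2.1, ?_⟩
    rw [← h2.2]
    refine setIntegral_congr_fun hC.measurableSet fun y hy => ?_
    beta_reduce
    rw [inChart_integralA ν θ i (hCT hy)]
  rw [integral_finsetSum _ fun i _ => (key i).1]
  exact Finset.sum_congr rfl fun i _ => (key i).2

/-- `∫_{∂M}` and `∫_A` commute, for families of forms supported in one compact set. -/
theorem integralBdry_integralA (o : MOrientation n M) {θ : A → DForm n M n} {K : Set M}
    (hK : IsCompact K) (hθ : ∀ a, ∀ m ∉ K, θ a m = 0) (hint : AbsConvergesOnBdry ν θ) :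
    integralBdry o (integralA ν θ) = ∫ a, integralBdry o (θ a) ∂ν := by
  simp only [integralBdry_eq_sum o hK (integralA_eq_zero ν hθ), integralBdry_eq_sum o hK (hθ _)]
  have key : ∀ i, Integrable (fun a => chartIntegralBdry o i ((ρ i : M → ℝ) • θ a)) ν ∧
      chartIntegralBdry o i ((ρ i : M → ℝ) • integralA ν θ) =
        ∫ a, chartIntegralBdry o i ((ρ i : M → ℝ) • θ a) ∂ν := fun i => by
    have hC := isCompact_bdryPt_preimage (isCompact_image_extChartAt (n := n)
      (isCompact_inter_tsupport hK i) (inter_tsupport_subset K i))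
    have hCT := preimage_mono (f := bdryPt)
      (image_extChartAt_subset (inter_tsupport_subset (n := n) K i))
    have h1 := hint i _ hC hCT
    rw [IntegrableOn, ← Measure.prod_restrict, Measure.restrict_univ] at h1
    have h2 := integral_weight_swap (G := fun x a => inChart i (θ a) (bdryPt x)) h1
      ((((continuousOn_chartWeight o i).comp continuous_bdryPt.continuousOn hCT).neg
        ).aestronglyMeasurable hC.measurableSet)
      (fun x => (abs_neg _).trans_le (abs_chartWeight_le o i (bdryPt x)))
      (ContinuousAlternatingMap.apply ℝ _ ℝ fun j : Fin n => EuclideanSpace.single j.succ 1)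
    simp only [chartIntegralBdry_partition_smul o i (hθ _),
      chartIntegralBdry_partition_smul o i (integralA_eq_zero ν hθ)]
    refine ⟨h2.1, ?_⟩
    refine Eq.trans ?_ h2.2
    refine setIntegral_congr_fun hC.measurableSet fun x hx => ?_
    beta_reduce
    rw [inChart_integralA ν θ i (hCT hx)]
    rfl
  rw [integral_finsetSum _ fun i _ => (key i).1]
  exact Finset.sum_congr rfl fun i _ => (key i).2

end Fubini

end StatStokes

theorem theorem2p5p2 (n : ℕ)
    {M : Type*} [TopologicalSpace M] [T2Space M] [SigmaCompactSpace M]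
    [ChartedSpace (EuclideanHalfSpace (n + 1)) M] [IsManifold (𝓡∂ (n + 1)) ∞ M]
    (o : StatStokes.MOrientation n M)
    {A : Type*} [TopologicalSpace A] [ChartedSpace (StatStokes.symmForms (n + 1)) A]
    [IsManifold 𝓘(ℝ, StatStokes.symmForms (n + 1)) ∞ A] [MeasurableSpace A] [BorelSpace A]
    (hA : Nonempty (Diffeomorph 𝓘(ℝ, StatStokes.symmForms (n + 1))
      𝓘(ℝ, StatStokes.symmForms (n + 1)) A (StatStokes.innerProducts (n + 1)) ∞))
    (ν : Measure A) [SigmaFinite ν]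
    (f : M → Measure A) (hf : ∀ m, IsProbabilityMeasure (f m))
    (e : A → StatStokes.FormAut n M)
    (hflux : ∀ a, StatStokes.ConservesFlux (e a) n)
    (hnorm : StatStokes.IsNormalised f e n)
    (hnorm' : StatStokes.IsNormalised f e (n + 1))
    (θ : A → StatStokes.DForm n M n)
    (hθ : StatStokes.IsSmoothFamily (V := StatStokes.symmForms (n + 1)) θ)
    (K : Set M) (hK : IsCompact K) (hθK : ∀ a, ∀ m ∉ K, θ a m = 0)
    (hint : StatStokes.AbsConvergesOnM ν fun a => StatStokes.statDeriv f e a (θ a))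
    (hint' : StatStokes.AbsConvergesOnBdry ν θ) :
    StatStokes.integralM o
        (StatStokes.integralA ν fun a => StatStokes.statDeriv f e a (θ a)) =
      StatStokes.integralBdry o (StatStokes.integralA ν θ) := by
  have hsm : ∀ a, StatStokes.IsSmoothForm (θ a) := hθ.isSmoothForm
  have hd : ∀ a, StatStokes.statDeriv f e a (θ a) = StatStokes.dM (θ a) := fun a =>
    StatStokes.statDeriv_eq_dM hflux hnorm' a (hsm a)
  simp only [hd] at hint ⊢
  rw [StatStokes.integralM_integralA o hK
      (fun a _ hm => StatStokes.dM_eq_zero hK.isClosed (hθK a) hm) hint,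
    StatStokes.integralBdry_integralA o hK hθK hint']
  simp only [fun a => StatStokes.integralM_dM o (hsm a) hK (hθK a)]
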